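/- Let $k\ge 1$, let $M$ be a matching with $p$ edges in the complete graph $K_k$ on $v_1,\dots,v_k$, and let $H=K_k-pK_2$ be obtained from $K_k$ by deleting the edges of $M$. Call $v_i$ matched if it is an endpoint of an edge of $M$; its partner is then $v_{\ell_i}$, i.e. $v_iv_{\ell_i}\in M$. Let $t$ and $p_i,q_i$ $(1\le i\le k)$ be non-negative integers, and let $G=H_{p_1,\dots,p_k}^{q_1,\dots,q_k}$ be the generalized blow-up of $H$: each $v_i$ is replaced by $G_i=p_iK_t\cup q_iK_1$ (disjoint union), and every vertex of $G_i$ is joined to every vertex of $G_j$ whenever $v_iv_j\in E(H)$. Put $V_i^{p_i}=V(p_iK_t)$, $V_i^{q_i}=V(q_iK_1)$, $n_i=|V(G_i)|=tp_i+q_i$ and $n=|V(G)|$. Assume that $G$ is connected, and let $R_G(u,v)$ be the resistance distance: the potential difference between $u$ and $v$ when every edge of $G$ is a unit resistor and a unit current enters at $u$ and leaves at $v$. **(i)** Let $u\ne v$, and put $s_i=n-n_i-n_{\ell_i}$ if $v_i$ is matched **(a)**, and $s_i=n-n_i$ if $v_i$ is not matched **(b)**. Then $$R_G(u,v)=\begin{cases}\frac{2}{s_i},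 & u,v\in V_i^{q_i};\\[2pt] \frac{2s_i+t+1}{s_i(s_i+t)}, & u\in V_i^{p_i},\ v\in V_i^{q_i};\\[2pt] \frac{2}{s_i+t}, & u,v\in V_i^{p_i},\ uv\in E(G);\\[2pt] \frac{2(s_i+1)}{s_i(s_i+t)}, & u,v\in V_i^{p_i},\ uv\notin E(G).\end{cases}$$ **(ii)(a)** If $v_iv_j\in M$, then with $R_1=\frac{n_i+n_j}{n_in_j(n-n_i-n_j)}$, $$R_G(u,v)=R_1+\begin{cases}\frac{n_i-1}{n_i(n-n_i-n_j)}+\frac{n_j-1}{n_j(n-n_i-n_j)}, & u\in V_i^{q_i},\ v\in V_j^{q_j};\\[2pt] \frac{n-n_i-n_j+1}{(n-n_i-n_j)(n-n_i-n_j+t)}+\frac{n_in_j-n_i-n_j}{n_in_j(n-n_i-n_j)}, & u\in V_i^{p_i},\ v\in V_j^{q_j};\\[2pt] \frac{2(n-n_i-n_j+1)}{(n-n_i-n_j)(n-n_i-n_j+t)}-\frac{n_i+n_j}{n_in_j(n-n_i-n_j)}, & u\in V_i^{p_i},\ v\in V_j^{p_j}.\end{cases}$$ **(ii)(b)** If $i\ne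 j$, $v_i$ and $v_j$ are both matched and $v_iv_j\notin M$, then with $R_2=\frac{n-n_i}{nn_i(n-n_i-n_{\ell_i})}+\frac{n-n_j}{nn_j(n-n_j-n_{\ell_j})}$, $$R_G(u,v)=R_2+\begin{cases}\frac{n_i-1}{n_i(n-n_i-n_{\ell_i})}+\frac{n_j-1}{n_j(n-n_j-n_{\ell_j})}, & u\in V_i^{q_i},\ v\in V_j^{q_j};\\[2pt] \frac{(n_i-1)(n-n_i-n_{\ell_i}+1)+1-t}{n_i(n-n_i-n_{\ell_i})(n-n_i-n_{\ell_i}+t)}+\frac{n_j-1}{n_j(n-n_j-n_{\ell_j})}, & u\in V_i^{p_i},\ v\in V_j^{q_j};\\[2pt] \frac{(n_i-1)(n-n_i-n_{\ell_i}+1)+1-t}{n_i(n-n_i-n_{\ell_i})(n-n_i-n_{\ell_i}+t)}+\frac{(n_j-1)(n-n_j-n_{\ell_j}+1)+1-t}{n_j(n-n_j-n_{\ell_j})(n-n_j-n_{\ell_j}+t)}, & u\in V_i^{p_i},\ v\in V_j^{p_j}.\end{cases}$$ **(ii)(c)** If $v_i$ is matched and $v_j$ is not, then with $R_3=\frac{n-n_i}{nn_i(n-n_i-n_{\ell_i})}+\frac{1}{nn_j}$,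 $$R_G(u,v)=R_3+\begin{cases}\frac{n_i-1}{n_i(n-n_i-n_{\ell_i})}+\frac{n_j-1}{n_j(n-n_j)}, & u\in V_i^{q_i},\ v\in V_j^{q_j};\\[2pt] \frac{n_i-1}{n_i(n-n_i-n_{\ell_i})}+\frac{(n_j-1)(n-n_j+1)+1-t}{n_j(n-n_j)(n-n_j+t)}, & u\in V_i^{q_i},\ v\in V_j^{p_j};\\[2pt] \frac{(n_i-1)(n-n_i-n_{\ell_i}+1)+1-t}{n_i(n-n_i-n_{\ell_i})(n-n_i-n_{\ell_i}+t)}+\frac{n_j-1}{n_j(n-n_j)}, & u\in V_i^{p_i},\ v\in V_j^{q_j};\\[2pt] \frac{(n_i-1)(n-n_i-n_{\ell_i}+1)+1-t}{n_i(n-n_i-n_{\ell_i})(n-n_i-n_{\ell_i}+t)}+\frac{(n_j-1)(n-n_j+1)+1-t}{n_j(n-n_j)(n-n_j+t)}, & u\in V_i^{p_i},\ v\in V_j^{p_j}.\end{cases}$$ **(ii)(d)** If $i\ne j$ and neither $v_i$ nor $v_j$ is matched, then with $R_4=\frac{1}{nn_i}+\frac{1}{nn_j}$, $$R_G(u,v)=R_4+\begin{cases}\frac{n_i-1}{n_i(n-n_i)}+\frac{n_j-1}{n_j(n-n_j)},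 & u\in V_i^{q_i},\ v\in V_j^{q_j};\\[2pt] \frac{(n_i-1)(n-n_i+1)+1-t}{n_i(n-n_i)(n-n_i+t)}+\frac{n_j-1}{n_j(n-n_j)}, & u\in V_i^{p_i},\ v\in V_j^{q_j};\\[2pt] \frac{(n_i-1)(n-n_i+1)+1-t}{n_i(n-n_i)(n-n_i+t)}+\frac{(n_j-1)(n-n_j+1)+1-t}{n_j(n-n_j)(n-n_j+t)}, & u\in V_i^{p_i},\ v\in V_j^{p_j}.\end{cases}$$ -/

import Mathlib

open Classical in
/-- `f` is an electric potential on the network `G` (every edge a unit resistor) when a unit current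
enters at `u` and leaves at `v`: by Ohm's law the current from `w` to a neighbour `x` is `f w - f x`,
and by Kirchhoff's law the net current leaving `w` is `1` at `u`, `-1` at `v`, and `0` elsewhere. -/
def IsUnitPotential {V : Type*} [Fintype V] (G : SimpleGraph V) (u v : V) (f : V → ℝ) : Prop :=
  ∀ w, (∑ x, if G.Adj w x then f w - f x else 0) =
    (if w = u then 1 else 0) - (if w = v then 1 else 0)

open Classical in
/-- The resistance distance (effective resistance) between `u` and `v`: the potential difference
between `u` and `v` when a unit current enters at `u` and leaves at `v`. Such a potential exists for
all `u`, `v` if `G` is connected; the value `0` is a placeholder where there is none. -/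
noncomputable def resistanceDist {V : Type*} [Fintype V] (G : SimpleGraph V) (u v : V) : ℝ :=
  if h : ∃ f, IsUnitPotential G u v f then h.choose u - h.choose v else 0

/-- Green's identity: the graph Laplacian is symmetric. -/
theorem sum_mul_laplacian_symm {V : Type*} [Fintype V] (G : SimpleGraph V) [DecidableRel G.Adj]
    (f g : V → ℝ) :
    (∑ w, g w * ∑ x, if G.Adj w x then f w - f x else 0) =
      ∑ w, f w * ∑ x, if G.Adj w x then g w - g x else 0 := by
  simp only [Finset.mul_sum]
  rw [← sub_eq_zero, ← Finset.sum_sub_distrib]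
  simp only [← Finset.sum_sub_distrib]
  have key : (∑ w, ∑ x, if G.Adj w x then f w * g x else 0) =
      ∑ w, ∑ x, if G.Adj w x then g w * f x else 0 := by
    rw [Finset.sum_comm]
    refine Finset.sum_congr rfl fun w _ => Finset.sum_congr rfl fun x _ => ?_
    simp only [G.adj_comm x w, mul_comm]
  rw [← sub_eq_zero, ← Finset.sum_sub_distrib] at key
  simp only [← Finset.sum_sub_distrib] at key
  refine Eq.trans ?_ key
  refine Finset.sum_congr rfl fun w _ => Finset.sum_congr rfl fun x _ => ?_
  split_ifs <;> ring

/-- The resistance distance does not depend on the choice of the potential. -/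
theorem resistanceDist_eq {V : Type*} [Fintype V] {G : SimpleGraph V} {u v : V} {f : V → ℝ}
    (hf : IsUnitPotential G u v f) : resistanceDist G u v = f u - f v := by
  classical
  have h : ∃ f, IsUnitPotential G u v f := ⟨f, hf⟩
  rw [resistanceDist, dif_pos h]
  have hg := h.choose_spec
  generalize h.choose = g at hg
  have e := sum_mul_laplacian_symm G f g
  unfold IsUnitPotential at hf hg
  have hf' : ∀ w, (∑ x, if G.Adj w x then f w - f x else 0) =
    (if w = u then 1 else 0) - (if w = v then 1 else 0) := fun w => by
      convert hf w
  have hg' : ∀ w, (∑ x, if G.Adj w x then g w - g x else 0) =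
    (if w = u then 1 else 0) - (if w = v then 1 else 0) := fun w => by
      convert hg w
  simp only [hf', hg', mul_sub, Finset.sum_sub_distrib, mul_ite, mul_one, mul_zero,
    Finset.sum_ite_eq', Finset.mem_univ, if_true] at e
  exact e

/-- The generalized join graph `H[G_1, …, G_k]`: every vertex `i` of `H` is replaced by the graph
`G i`, and every vertex of `G i` is joined to every vertex of `G j` whenever `i j` is an edge of
`H`. -/
def generalizedJoin {ι : Type*} {W : ι → Type*} (H : SimpleGraph ι) (G : ∀ i, SimpleGraph (W i)) :
    SimpleGraph (Σ i, W i) where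
  Adj x y := H.Adj x.1 y.1 ∨ ∃ i a b, (G i).Adj a b ∧ x = ⟨i, a⟩ ∧ y = ⟨i, b⟩
  symm := ⟨by
    rintro x y (h | ⟨i, a, b, h, rfl, rfl⟩)
    · exact Or.inl h.symm
    · exact Or.inr ⟨i, b, a, h.symm, rfl, rfl⟩⟩
  loopless := ⟨by
    rintro x (h | ⟨i, a, b, h, rfl, hb⟩)
    · exact H.loopless.irrefl _ h
    · obtain rfl : a = b := by simpa using hb
      exact (G i).loopless.irrefl _ h⟩

/-- The disjoint union `p K_t` of `p` complete graphs on `t` vertices. -/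
def disjointCliques (p t : ℕ) : SimpleGraph (Fin p × Fin t) where
  Adj x y := x.1 = y.1 ∧ x.2 ≠ y.2
  symm := ⟨fun _ _ h => ⟨h.1.symm, h.2.symm⟩⟩
  loopless := ⟨fun _ h => h.2 rfl⟩

/-- The vertex set of `p K_t ∪ q K_1`. -/
abbrev BlockVertex (t p q : ℕ) : Type := (Fin p × Fin t) ⊕ Fin q

/-- The graph `p K_t ∪ q K_1`. -/
def blockGraph (t p q : ℕ) : SimpleGraph (BlockVertex t p q) :=
  (disjointCliques p t).sum (⊥ : SimpleGraph (Fin q))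

/-- The vertex set of the generalized blow-up graph. -/
abbrev BlowUpVertex {k : ℕ} (t : ℕ) (p q : Fin k → ℕ) : Type :=
  Σ i : Fin k, BlockVertex t (p i) (q i)

/-- The generalized blow-up graph: the generalized join `H[G_1, …, G_k]` with
`G_i = p_i K_t ∪ q_i K_1`. -/
def blowUp {k : ℕ} (H : SimpleGraph (Fin k)) (t : ℕ) (p q : Fin k → ℕ) :
    SimpleGraph (BlowUpVertex t p q) :=
  generalizedJoin H fun i => blockGraph t (p i) (q i)

/-- `V_i^{p_i}`: the vertices of the cliques `p_i K_t` in the part that replaces `v_i`. -/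
def cliquePart {k : ℕ} (t : ℕ) (p q : Fin k → ℕ) (i : Fin k) : Set (BlowUpVertex t p q) :=
  {x | ∃ a : Fin (p i) × Fin t, x = ⟨i, Sum.inl a⟩}

/-- `V_i^{q_i}`: the vertices of `q_i K_1` in the part that replaces `v_i`. -/
def isolatedPart {k : ℕ} (t : ℕ) (p q : Fin k → ℕ) (i : Fin k) : Set (BlowUpVertex t p q) :=
  {x | ∃ c : Fin (q i), x = ⟨i, Sum.inr c⟩}

/-! Two parts joined by an edge of `M` have no edges between them, so together they form one
disjoint union of cliques, an isolated vertex being a clique of size 1. Hence `G` carries two nested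
equivalence relations, `B` (equal or matched parts) and `C` (same clique), and distinct vertices are
adjacent iff they are `C`-related or not `B`-related.

Write N for the order of `G`, s for N minus the size of the `B`-class of u, and τ for the size of
its `C`-class. The Laplacian maps the indicators of {u}, of the `C`-class and of the `B`-class into
their span plus constants. When s ≠ 0 this can be solved explicitly for a potential `green` whose
Laplacian is δ_u - 1/N. The difference of two such potentials is a unit potential, so resistances
can be read off: different `B`-classes give the sum over both endpoints of (s+1)/(s(s+τ)) - 1/(Ns);
same `B`-class but different cliques give the sum of (s+1)/(s(s+τ)); the same clique gives 2/(s+τ).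
Every formula of the theorem is one of these with τ = t or τ = 1, up to algebra; (ii)(a) is of the
second kind, since matched parts share a `B`-class. -/

open Classical in
/-- The action of the graph Laplacian on a real function on the vertices. -/
noncomputable def laplace {V : Type*} [Fintype V] (G : SimpleGraph V) (f : V → ℝ) (w : V) : ℝ :=
  ∑ x, if G.Adj w x then f w - f x else 0

/-! ### Nested equivalence relations and their class sizes. -/

/-- A graph in which vertices from different classes of `B` are adjacent, and each class of `B`
induces a disjoint union of cliques, namely the classes of the finer relation `C`. -/
structure IsJoinOfCliques {V : Type*} (G : SimpleGraph V) (B C : Setoid V) : Prop where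
  le : C ≤ B
  adj_iff : ∀ x y, G.Adj x y ↔ ¬ B x y ∨ (C x y ∧ x ≠ y)

open Classical in
/-- The number of elements of the class of `u`. -/
noncomputable def classSize {V : Type*} [Fintype V] (S : Setoid V) (u : V) : ℝ :=
  ∑ x, if S u x then 1 else 0

theorem classSize_pos {V : Type*} [Fintype V] (S : Setoid V) (u : V) : 0 < classSize S u := by
  classical
  unfold classSize
  have h : (∑ x, if x = u then (1 : ℝ) else 0) ≤ ∑ x, if S u x then 1 else 0 := by
    refine Finset.sum_le_sum fun x _ => ?_
    by_cases hx : x = u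
    · subst hx; simp
    · rw [if_neg hx]; split_ifs <;> norm_num
  simp only [Finset.sum_ite_eq', Finset.mem_univ, if_true] at h
  linarith

theorem classSize_congr {V : Type*} [Fintype V] {S : Setoid V} {u v : V} (h : S u v) :
    classSize S u = classSize S v := by
  classical
  refine Finset.sum_congr rfl fun x _ => ?_
  have : S u x ↔ S v x := ⟨fun hx => S.trans (S.symm h) hx, fun hx => S.trans h hx⟩
  simp only [this]

theorem classSize_le_card {V : Type*} [Fintype V] (S : Setoid V) (u : V) :
    classSize S u ≤ Fintype.card V := by
  classical
  calc classSize S u ≤ ∑ _x : V, (1 : ℝ) :=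
        Finset.sum_le_sum fun x _ => by split_ifs <;> norm_num
    _ = Fintype.card V := by simp

theorem rel_of_classSize_eq_card {V : Type*} [Fintype V] {S : Setoid V} {u : V}
    (h : classSize S u = Fintype.card V) (x : V) : S u x := by
  classical
  have e : ∑ x, (1 - if S u x then (1 : ℝ) else 0) = 0 := by
    rw [Finset.sum_sub_distrib]
    change _ - classSize S u = 0
    rw [h]; simp
  have h0 := (Finset.sum_eq_zero_iff_of_nonneg (fun x _ => by split_ifs <;> norm_num)).1 e x
    (Finset.mem_univ x)
  by_contra hx
  rw [if_neg hx] at h0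
  norm_num at h0

open Classical in
/-- Summing over the part of a class of `T` in a class of a coarser relation `S`. -/
theorem sum_rel_mul_rel {V : Type*} [Fintype V] {S T : Setoid V} (h : T ≤ S) (w u : V) :
    (∑ x, if S w x then (if T u x then (1 : ℝ) else 0) else 0) =
      if S u w then classSize T u else 0 := by
  split_ifs with hw
  · refine Finset.sum_congr rfl fun x _ => ?_
    by_cases hx : T u x
    · rw [if_pos (S.trans (S.symm hw) (h hx))]
    · simp [hx]
  · refine Finset.sum_eq_zero fun x _ => ?_
    by_cases hx : T u x
    · rw [if_neg fun hs => hw (S.trans (h hx) (S.symm hs))]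
    · simp [hx]

/-! ### The Laplacian on indicator functions. -/

namespace IsJoinOfCliques

variable {V : Type*} [Fintype V] {G : SimpleGraph V} {B C : Setoid V}

-- Off the diagonal the adjacency indicator is 1 - [B] + [C]; on the diagonal the factor `f w - f w`
-- vanishes, so the same expression may be summed over all x.
open Classical in
theorem laplace_eq (hG : IsJoinOfCliques G B C) (f : V → ℝ) (w : V) :
    laplace G f w = (Fintype.card V - classSize B w + classSize C w) * f w - ∑ x, f x +
      (∑ x, if B w x then f x else 0) - ∑ x, if C w x then f x else 0 := by
  have hpt : ∀ x, (if G.Adj w x then f w - f x else 0) =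
      f w - (if B w x then 1 else 0) * f w + (if C w x then 1 else 0) * f w - f x +
        (if B w x then f x else 0) - if C w x then f x else 0 := fun x => by
    by_cases hx : w = x
    · subst hx
      simp only [SimpleGraph.irrefl, B.refl, C.refl, if_true, if_false]
      ring
    · by_cases hc : C w x
      · simp only [hG.adj_iff, hG.le hc, hc, hx, ne_eq, not_true, not_false_iff, and_self,
          or_true, if_true]
        ring
      · by_cases hb : B w x <;>
          simp only [hG.adj_iff, hb, hc, not_true, not_false_iff, false_and, or_false,
            if_true, if_false] <;> ring
  unfold laplace
  simp only [hpt, Finset.sum_add_distrib, Finset.sum_sub_distrib, ← Finset.sum_mul]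
  change _ - classSize B w * _ + classSize C w * _ - _ + _ - _ = _
  simp only [Finset.sum_const, Finset.card_univ, nsmul_eq_mul]
  ring

-- This and the next two lemmas are the action on the three indicators; modulo constants it is
-- triangular, with diagonal entries s + τ, s and N.
open Classical in
theorem laplace_single (hG : IsJoinOfCliques G B C) (u w : V) :
    laplace G (fun x => if x = u then 1 else 0) w =
      (Fintype.card V - classSize B u + classSize C u) * (if w = u then 1 else 0) - 1 +
        (if B u w then 1 else 0) - if C u w then 1 else 0 := by
  have hs : ∀ S : Setoid V, (∑ x, if S w x then (if x = u then (1 : ℝ) else 0) else 0) =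
      if S u w then 1 else 0 := fun S => by
    have : ∀ x, (if S w x then (if x = u then (1 : ℝ) else 0) else 0) =
        if x = u then (if S u w then 1 else 0) else 0 := fun x => by
      by_cases hx : x = u
      · subst hx; simp [S.comm' (x := w) (y := x)]
      · simp [hx]
    simp [this]
  rw [hG.laplace_eq, hs, hs]
  simp only [Finset.sum_ite_eq', Finset.mem_univ, if_true]
  by_cases hw : w = u
  · subst hw; rfl
  · simp [hw]

open Classical in
theorem laplace_clique (hG : IsJoinOfCliques G B C) (u w : V) :
    laplace G (fun x => if C u x then 1 else 0) w =
      (Fintype.card V - classSize B u) * (if C u w then 1 else 0) - classSize C u +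
        (if B u w then 1 else 0) * classSize C u := by
  rw [hG.laplace_eq, sum_rel_mul_rel hG.le, sum_rel_mul_rel le_rfl]
  change _ - classSize C u + _ - _ = _
  by_cases hw : C u w
  · rw [← classSize_congr hw, ← classSize_congr (hG.le hw), if_pos hw, if_pos hw,
      if_pos (hG.le hw), if_pos (hG.le hw)]
    ring
  · simp only [hw, if_false]
    split_ifs <;> ring

open Classical in
theorem laplace_class (hG : IsJoinOfCliques G B C) (u w : V) :
    laplace G (fun x => if B u x then 1 else 0) w =
      (if B u w then 1 else 0) * (Fintype.card V : ℝ) - classSize B u := by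
  have hC : (∑ x, if C w x then (if B u x then (1 : ℝ) else 0) else 0) =
      if B u w then classSize C w else 0 := by
    split_ifs with hw
    · refine Finset.sum_congr rfl fun x _ => ?_
      by_cases hx : C w x
      · rw [if_pos hx, if_pos hx, if_pos (B.trans hw (hG.le hx))]
      · simp [hx]
    · refine Finset.sum_eq_zero fun x _ => ?_
      by_cases hx : C w x
      · rw [if_pos hx, if_neg fun hs => hw (B.trans hs (B.symm (hG.le hx)))]
      · simp [hx]
  rw [hG.laplace_eq, sum_rel_mul_rel le_rfl, hC]
  change _ - classSize B u + _ - _ = _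
  by_cases hw : B u w
  · rw [← classSize_congr hw]
    simp only [hw, if_true]
    ring
  · simp [hw]

theorem laplace_linear (a b c : ℝ) (f g h : V → ℝ) (w : V) :
    laplace G (fun x => a * f x + b * g x + c * h x) w =
      a * laplace G f w + b * laplace G g w + c * laplace G h w := by
  classical
  unfold laplace
  simp only [Finset.mul_sum, ← Finset.sum_add_distrib]
  refine Finset.sum_congr rfl fun x _ => ?_
  split_ifs <;> ring

/-! ### Green's function and the three resistance formulas. -/

open Classical in
/-- The potential of a unit current that enters at `u` and leaves uniformly at all vertices. -/
noncomputable def green (B C : Setoid V) (u w : V) : ℝ :=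
  1 / (Fintype.card V - classSize B u + classSize C u) * (if w = u then 1 else 0) +
  1 / ((Fintype.card V - classSize B u) * (Fintype.card V - classSize B u + classSize C u)) *
    (if C u w then 1 else 0) +
  -(1 / (Fintype.card V * (Fintype.card V - classSize B u))) * (if B u w then 1 else 0)

-- The coefficients come from the triangular system: 1/(s+τ) normalises δ_u, the second cancels the
-- resulting -[C], and the third cancels [B], whose coefficient is by then 1/(s+τ) + τ/(s(s+τ)) =
-- 1/s. The constant that remains is -1/N.
open Classical in
theorem laplace_green (hG : IsJoinOfCliques G B C) {u : V} (w : V)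
    (hs : (Fintype.card V : ℝ) - classSize B u ≠ 0) :
    laplace G (green B C u) w = (if w = u then 1 else 0) - 1 / Fintype.card V := by
  have hN : (Fintype.card V : ℝ) ≠ 0 := by
    have := classSize_pos B u; have := classSize_le_card B u; linarith
  have hst : (Fintype.card V : ℝ) - classSize B u + classSize C u ≠ 0 := by
    have := classSize_pos C u; have := classSize_le_card B u; linarith
  have := laplace_linear (G := G)
    (1 / (Fintype.card V - classSize B u + classSize C u))
    (1 / ((Fintype.card V - classSize B u) * (Fintype.card V - classSize B u + classSize C u)))
    (-(1 / (Fintype.card V * (Fintype.card V - classSize B u))))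
    (fun w => if w = u then 1 else 0) (fun w => if C u w then 1 else 0)
    (fun w => if B u w then 1 else 0) w
  rw [hG.laplace_single, hG.laplace_clique, hG.laplace_class] at this
  refine Eq.trans this ?_
  generalize (if w = u then (1 : ℝ) else 0) = x
  generalize (if C u w then (1 : ℝ) else 0) = y
  generalize (if B u w then (1 : ℝ) else 0) = z
  generalize hb : (Fintype.card V : ℝ) - classSize B u = s at *
  rw [show classSize B u = Fintype.card V - s by linarith]
  field_simp
  ring

/-- The uniform sinks 1/N of the two Green's functions cancel in their difference. -/
theorem resistanceDist_eq_green (hG : IsJoinOfCliques G B C) {u v : V}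
    (hu : (Fintype.card V : ℝ) - classSize B u ≠ 0)
    (hv : (Fintype.card V : ℝ) - classSize B v ≠ 0) :
    resistanceDist G u v = green B C u u - green B C v u - (green B C u v - green B C v v) := by
  classical
  refine resistanceDist_eq (f := fun w => green B C u w - green B C v w) fun w => ?_
  have h := laplace_linear (G := G) 1 (-1) 0 (green B C u) (green B C v) 0 w
  rw [hG.laplace_green w hu, hG.laplace_green w hv] at h
  convert h using 1
  · unfold laplace
    refine Finset.sum_congr rfl fun x _ => ?_
    congr 1
    simp only [Pi.zero_apply]; ring
  · ring

/-- Resistance distance between vertices in different classes of `B`. -/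
theorem resistanceDist_of_not_rel (hG : IsJoinOfCliques G B C) {u v : V} (h : ¬ B u v)
    {N s s' τ τ' : ℝ} (hN : N = Fintype.card V)
    (hs : s = N - classSize B u) (hs' : s' = N - classSize B v)
    (hτ : τ = classSize C u) (hτ' : τ' = classSize C v) :
    0 < s ∧ 0 < s' ∧ resistanceDist G u v =
      ((s + 1) / (s * (s + τ)) - 1 / (N * s)) + ((s' + 1) / (s' * (s' + τ')) - 1 / (N * s')) := by
  have hB' : ¬ B v u := fun h' => h (B.symm h')
  have hu : 0 < (Fintype.card V : ℝ) - classSize B u :=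
    sub_pos.2 <| lt_of_le_of_ne (classSize_le_card B u) fun e => h (rel_of_classSize_eq_card e v)
  have hv : 0 < (Fintype.card V : ℝ) - classSize B v :=
    sub_pos.2 <| lt_of_le_of_ne (classSize_le_card B v) fun e => hB' (rel_of_classSize_eq_card e u)
  have hC : ¬ C u v := fun h' => h (hG.le h')
  have hC' : ¬ C v u := fun h' => hB' (hG.le h')
  have hne : u ≠ v := fun e => h (e ▸ B.refl u)
  rw [hG.resistanceDist_eq_green hu.ne' hv.ne']
  subst hN
  rw [← hs] at hu; rw [← hs'] at hv
  refine ⟨hu, hv, ?_⟩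
  have hpu := classSize_pos C u
  have hpv := classSize_pos C v
  rw [← hτ] at hpu; rw [← hτ'] at hpv
  simp only [green, B.refl, C.refl, h, hB', hC, hC', hne, hne.symm, if_true, if_false, ← hs, ← hs',
    ← hτ, ← hτ']
  have : s + τ ≠ 0 := by positivity
  have : s' + τ' ≠ 0 := by positivity
  field_simp
  ring

/-- If `G` is connected and the class of `u` is everything, then it is a single clique. -/
theorem card_sub_classSize_pos (hG : IsJoinOfCliques G B C) (hconn : G.Connected) {u v : V}
    (h : ¬ C u v) : 0 < (Fintype.card V : ℝ) - classSize B u := by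
  refine sub_pos.2 <| lt_of_le_of_ne (classSize_le_card B u) fun e => h ?_
  have hB := rel_of_classSize_eq_card e
  -- With a single `B`-class no edge leaves a clique, so a walk from u to v would stay in the clique
  -- of u.
  have hadj : ∀ x y, G.Adj x y → C x y := fun x y hxy => by
    rcases (hG.adj_iff x y).1 hxy with h | h
    · exact absurd (B.trans (B.symm (hB x)) (hB y)) h
    · exact h.1
  obtain ⟨w⟩ := hconn.preconnected u v
  clear e h hB
  induction w with
  | nil => exact C.refl _
  | cons h _ ih => exact C.trans (hadj _ _ h) ih

/-- Resistance distance between vertices of different cliques in one class of `B`. -/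
theorem resistanceDist_of_rel (hG : IsJoinOfCliques G B C) (hconn : G.Connected) {u v : V}
    (hB : B u v) (h : ¬ C u v) {s τ τ' : ℝ} (hs : s = Fintype.card V - classSize B u)
    (hτ : τ = classSize C u) (hτ' : τ' = classSize C v) :
    0 < s ∧ resistanceDist G u v = (s + 1) / (s * (s + τ)) + (s + 1) / (s * (s + τ')) := by
  have hu := hG.card_sub_classSize_pos hconn h
  have hs' := hs
  rw [classSize_congr hB] at hs'
  have hC' : ¬ C v u := fun h' => h (C.symm h')
  have hne : u ≠ v := fun e => h (e ▸ C.refl u)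
  rw [hG.resistanceDist_eq_green hu.ne' (by rw [← classSize_congr hB]; exact hu.ne')]
  rw [← hs] at hu
  refine ⟨hu, ?_⟩
  have hpu := classSize_pos C u
  have hpv := classSize_pos C v
  rw [← hτ] at hpu; rw [← hτ'] at hpv
  simp only [green, B.refl, C.refl, hB, B.symm hB, h, hC', hne, hne.symm, if_true, if_false, ← hs,
    ← hs', ← hτ, ← hτ']
  have : s + τ ≠ 0 := by positivity
  have : s + τ' ≠ 0 := by positivity
  field_simp
  ring

/-- Resistance distance between vertices of one clique. -/
theorem resistanceDist_of_clique (hG : IsJoinOfCliques G B C) {u v : V} (h : C u v) (hne : u ≠ v)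
    {s τ : ℝ} (hs : s = Fintype.card V - classSize B u) (hτ : τ = classSize C u) :
    resistanceDist G u v = 2 / (s + τ) := by
  classical
  have hpos : 0 < s + τ := by
    have := classSize_pos C u; have := classSize_le_card B u; linarith
  -- Here (δ_u - δ_v)/(s+τ) is already a unit potential, as u and v have the same classes. This also
  -- covers s = 0, where `green` is unavailable and `G` may be one clique. The term `0 * 0` only
  -- matches the shape of `laplace_linear`.
  rw [resistanceDist_eq (f := fun w => 1 / (s + τ) * (if w = u then 1 else 0) +
    -(1 / (s + τ)) * (if w = v then 1 else 0) + 0 * 0)]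
  · simp only [hne, hne.symm, if_true, if_false]
    ring
  · intro w
    have e := laplace_linear (G := G) (1 / (s + τ)) (-(1 / (s + τ))) 0
      (fun w => if w = u then 1 else 0) (fun w => if w = v then 1 else 0) (fun _ => 0) w
    have hBw : B u w ↔ B v w :=
      ⟨fun hx => B.trans (B.symm (hG.le h)) hx, fun hx => B.trans (hG.le h) hx⟩
    have hCw : C u w ↔ C v w := ⟨fun hx => C.trans (C.symm h) hx, fun hx => C.trans h hx⟩
    rw [hG.laplace_single, hG.laplace_single, ← classSize_congr h, ← classSize_congr (hG.le h),
      ← hs, ← hτ] at e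
    simp only [hBw, hCw] at e
    refine Eq.trans ?_ (e.trans ?_)
    · unfold laplace
      rfl
    · field_simp
      ring

end IsJoinOfCliques

/-! ### The blow-up as a join of cliques. -/

theorem SimpleGraph.Subgraph.IsMatching.adj_unique {W : Type*} {K : SimpleGraph W}
    {M : K.Subgraph} (hM : M.IsMatching) {a b c : W} (hb : M.Adj a b) (hc : M.Adj a c) : b = c :=
  (hM (M.edge_vert hb)).unique hb hc

/-- The relation "equal or matched" of a matching. -/
def matchingSetoid {W : Type*} {K : SimpleGraph W} (M : K.Subgraph) (hM : M.IsMatching) :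
    Setoid W where
  r a b := a = b ∨ M.Adj a b
  iseqv :=
    { refl := fun _ => Or.inl rfl
      symm := fun h => h.imp Eq.symm fun h => h.symm
      trans := by
        rintro a b c (rfl | hab) (rfl | hbc)
        · exact Or.inl rfl
        · exact Or.inr hbc
        · exact Or.inr hab
        -- Two matching edges at b coincide; transitivity rests on `M` being a matching.
        · exact Or.inl (hM.adj_unique hab.symm hbc) }

/-- The relation of lying in parts that are equal or matched. -/
def partSetoid {k : ℕ} (M : (⊤ : SimpleGraph (Fin k)).Subgraph) (hM : M.IsMatching)
    (t : ℕ) (p q : Fin k → ℕ) : Setoid (BlowUpVertex t p q) :=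
  (matchingSetoid M hM).comap Sigma.fst

/-- The clique of a vertex of `p K_t ∪ q K_1`, an isolated vertex counting as a clique. -/
def blockClique {t p q : ℕ} : BlockVertex t p q → Fin p ⊕ Fin q := Sum.map Prod.fst id

/-- The relation of lying in the same clique of the same part. -/
def cliqueSetoid {k : ℕ} (t : ℕ) (p q : Fin k → ℕ) : Setoid (BlowUpVertex t p q) :=
  Setoid.ker fun x => (⟨x.1, blockClique x.2⟩ : Σ i, Fin (p i) ⊕ Fin (q i))

theorem cliqueSetoid_mk {k : ℕ} {t : ℕ} {p q : Fin k → ℕ} {i : Fin k}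
    {a b : BlockVertex t (p i) (q i)} :
    cliqueSetoid t p q ⟨i, a⟩ ⟨i, b⟩ ↔ blockClique a = blockClique b := by
  change (⟨i, blockClique a⟩ : Σ i, Fin (p i) ⊕ Fin (q i)) = ⟨i, blockClique b⟩ ↔ _
  simp

theorem cliqueSetoid_fst {k : ℕ} {t : ℕ} {p q : Fin k → ℕ} {x y : BlowUpVertex t p q}
    (h : cliqueSetoid t p q x y) : x.1 = y.1 := by
  have e := Setoid.ker_def.1 h
  exact (Sigma.mk.inj_iff.1 e).1

theorem blockGraph_adj {t p q : ℕ} (a b : BlockVertex t p q) :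
    (blockGraph t p q).Adj a b ↔ blockClique a = blockClique b ∧ a ≠ b := by
  rcases a with ⟨a, c⟩ | a <;> rcases b with ⟨b, d⟩ | b
  · simp only [blockGraph, disjointCliques, blockClique, SimpleGraph.sum_adj, Sum.map_inl,
      Sum.inl.injEq, ne_eq, Prod.mk.injEq]
    grind
  all_goals simp [blockGraph, blockClique]

theorem isJoinOfCliques_blowUp {k : ℕ} (M : (⊤ : SimpleGraph (Fin k)).Subgraph)
    (hM : M.IsMatching) (t : ℕ) (p q : Fin k → ℕ) :
    IsJoinOfCliques (blowUp ((⊤ : SimpleGraph (Fin k)).deleteEdges M.edgeSet) t p q)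
      (partSetoid M hM t p q) (cliqueSetoid t p q) where
  le := fun {_ _} h => Or.inl (cliqueSetoid_fst h)
  adj_iff := by
    rintro ⟨i, a⟩ ⟨j, b⟩
    have hB : partSetoid M hM t p q ⟨i, a⟩ ⟨j, b⟩ ↔ i = j ∨ M.Adj i j := Iff.rfl
    rw [hB]
    constructor
    · rintro (h | ⟨l, c, d, h, hc, hd⟩)
      · simp only [SimpleGraph.deleteEdges_adj, SimpleGraph.top_adj,
          SimpleGraph.Subgraph.mem_edgeSet] at h
        exact Or.inl (not_or.2 h)
      · obtain ⟨h1, h2⟩ := (blockGraph_adj c d).1 h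
        rw [hc, hd]
        exact Or.inr ⟨cliqueSetoid_mk.2 h1, by simpa using h2⟩
    · rintro (h | ⟨h1, h2⟩)
      · refine Or.inl ?_
        simp only [SimpleGraph.deleteEdges_adj, SimpleGraph.top_adj,
          SimpleGraph.Subgraph.mem_edgeSet]
        exact not_or.1 h
      · obtain rfl : i = j := cliqueSetoid_fst h1
        refine Or.inr ⟨i, a, b, (blockGraph_adj a b).2 ⟨cliqueSetoid_mk.1 h1, ?_⟩, rfl, rfl⟩
        simpa using h2

/-! ### Class sizes in the blow-up. -/

open Classical in
theorem classSize_partSetoid {k : ℕ} (M : (⊤ : SimpleGraph (Fin k)).Subgraph)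
    (hM : M.IsMatching) (t : ℕ) (p q : Fin k → ℕ) (x : BlowUpVertex t p q) :
    classSize (partSetoid M hM t p q) x = ∑ j, if x.1 = j ∨ M.Adj x.1 j then
      (Fintype.card (BlockVertex t (p j) (q j)) : ℝ) else 0 := by
  unfold classSize
  rw [Fintype.sum_sigma]
  refine Finset.sum_congr rfl fun j _ => ?_
  have h : ∀ b, partSetoid M hM t p q x ⟨j, b⟩ ↔ x.1 = j ∨ M.Adj x.1 j := fun _ => Iff.rfl
  simp only [h]
  split_ifs
  · rw [Finset.sum_const, Finset.card_univ, nsmul_eq_mul, mul_one]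
  · simp

theorem classSize_partSetoid_of_adj {k : ℕ} {M : (⊤ : SimpleGraph (Fin k)).Subgraph}
    (hM : M.IsMatching) (t : ℕ) (p q : Fin k → ℕ) {x : BlowUpVertex t p q} {l : Fin k}
    (h : M.Adj x.1 l) :
    classSize (partSetoid M hM t p q) x = Fintype.card (BlockVertex t (p x.1) (q x.1)) +
      Fintype.card (BlockVertex t (p l) (q l)) := by
  classical
  rw [classSize_partSetoid]
  have hset : (Finset.univ.filter fun j => x.1 = j ∨ M.Adj x.1 j) = {x.1, l} := by
    ext j
    simp only [Finset.mem_filter, Finset.mem_univ, true_and, Finset.mem_insert,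
      Finset.mem_singleton]
    constructor
    · rintro (rfl | hj)
      · exact Or.inl rfl
      · exact Or.inr (hM.adj_unique hj h)
    · rintro (rfl | rfl)
      · exact Or.inl rfl
      · exact Or.inr h
  rw [← Finset.sum_filter, hset, Finset.sum_pair h.ne]

theorem classSize_partSetoid_of_notMem {k : ℕ} {M : (⊤ : SimpleGraph (Fin k)).Subgraph}
    (hM : M.IsMatching) (t : ℕ) (p q : Fin k → ℕ) {x : BlowUpVertex t p q} (h : x.1 ∉ M.verts) :
    classSize (partSetoid M hM t p q) x = Fintype.card (BlockVertex t (p x.1) (q x.1)) := by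
  classical
  rw [classSize_partSetoid]
  have hset : ∀ j, (x.1 = j ∨ M.Adj x.1 j) ↔ x.1 = j :=
    fun j => or_iff_left fun hj => h (M.edge_vert hj)
  simp only [hset, Finset.sum_ite_eq, Finset.mem_univ, if_true]

open Classical in
theorem classSize_cliqueSetoid {k : ℕ} {t : ℕ} {p q : Fin k → ℕ} (i : Fin k)
    (a : BlockVertex t (p i) (q i)) :
    classSize (cliqueSetoid t p q) ⟨i, a⟩ =
      ∑ b : BlockVertex t (p i) (q i), if blockClique a = blockClique b then (1 : ℝ) else 0 := by
  unfold classSize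
  rw [Fintype.sum_sigma, Finset.sum_eq_single i]
  · refine Finset.sum_congr rfl fun b _ => ?_
    simp only [cliqueSetoid_mk]
  · intro j _ hj
    exact Finset.sum_eq_zero fun b _ => if_neg fun h => hj (cliqueSetoid_fst h).symm
  · simp

theorem classSize_cliqueSetoid_inl {k : ℕ} {t : ℕ} {p q : Fin k → ℕ} (i : Fin k)
    (a : Fin (p i) × Fin t) : classSize (cliqueSetoid t p q) ⟨i, Sum.inl a⟩ = t := by
  rw [classSize_cliqueSetoid, Fintype.sum_sum_type, Fintype.sum_prod_type]
  simp [blockClique]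

theorem classSize_cliqueSetoid_inr {k : ℕ} {t : ℕ} {p q : Fin k → ℕ} (i : Fin k)
    (a : Fin (q i)) : classSize (cliqueSetoid t p q) ⟨i, Sum.inr a⟩ = 1 := by
  rw [classSize_cliqueSetoid, Fintype.sum_sum_type, Fintype.sum_prod_type]
  simp [blockClique]

/-! ### Matching the endpoint terms with the stated fractions. -/

/-- The right side is the endpoint contribution with τ = 1, left uncancelled so that it matches
`resistanceDist_of_not_rel`; the left side is the endpoint's share of the stated formula.
`clique_term` does the same for τ = t. -/
theorem isolated_term {N n s : ℝ} (hN : N ≠ 0) (hn : n ≠ 0) (hs : 0 < s) :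
    (N - n) / (N * n * s) + (n - 1) / (n * s) = (s + 1) / (s * (s + 1)) - 1 / (N * s) := by
  have : s + 1 ≠ 0 := by positivity
  field_simp
  ring

theorem clique_term {N n s t : ℝ} (hN : N ≠ 0) (hn : n ≠ 0) (hs : 0 < s) (ht : 0 ≤ t) :
    (N - n) / (N * n * s) + ((n - 1) * (s + 1) + 1 - t) / (n * s * (s + t)) =
      (s + 1) / (s * (s + t)) - 1 / (N * s) := by
  have : s + t ≠ 0 := by positivity
  field_simp
  ring

/-- For an unmatched part s = N - n, so its summand in R₃ and R₄ has the same shape as that of a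
matched part. -/
theorem unmatched_term {N n : ℝ} (hs : 0 < N - n) :
    1 / (N * n) = (N - n) / (N * n * (N - n)) :=  by
  rw [div_mul_cancel_right₀ hs.ne', one_div]

theorem corollaryc34 {k m : ℕ}
    -- the matching `M` of `m` edges in `K_k`, and `H = K_k - m K_2`
    (M : (⊤ : SimpleGraph (Fin k)).Subgraph) (hM : M.IsMatching) (hm : M.edgeSet.ncard = m)
    (H : SimpleGraph (Fin k)) (hH : H = (⊤ : SimpleGraph (Fin k)).deleteEdges M.edgeSet)
    -- the generalized blow-up graph `G` of `H`
    (t : ℕ) (p q : Fin k → ℕ)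
    (G : SimpleGraph (BlowUpVertex t p q)) (hG : G = blowUp H t p q) (hconn : G.Connected)
    -- the sizes `n i = |V(G_i)|` and `N = |V(G)|`
    (n : Fin k → ℝ) (hn : ∀ i, n i = (Fintype.card (BlockVertex t (p i) (q i)) : ℝ))
    (N : ℝ) (hN : N = (Fintype.card (BlowUpVertex t p q) : ℝ)) :
    -- (i)(a)
    (∀ i l, M.Adj i l → ∀ u v, u ≠ v →
      (u ∈ isolatedPart t p q i → v ∈ isolatedPart t p q i →
        resistanceDist G u v = 2 / (N - n i - n l)) ∧
      (u ∈ cliquePart t p q i → v ∈ isolatedPart t p q i →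
        resistanceDist G u v =
          (2 * (N - n i - n l) + t + 1) / ((N - n i - n l) * (N - n i - n l + t))) ∧
      (u ∈ cliquePart t p q i → v ∈ cliquePart t p q i → G.Adj u v →
        resistanceDist G u v = 2 / (N - n i - n l + t)) ∧
      (u ∈ cliquePart t p q i → v ∈ cliquePart t p q i → ¬ G.Adj u v →
        resistanceDist G u v =
          2 * (N - n i - n l + 1) / ((N - n i - n l) * (N - n i - n l + t)))) ∧
    -- (i)(b)
    (∀ i, i ∉ M.verts → ∀ u v, u ≠ v →
      (u ∈ isolatedPart t p q i → v ∈ isolatedPart t p q i →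
        resistanceDist G u v = 2 / (N - n i)) ∧
      (u ∈ cliquePart t p q i → v ∈ isolatedPart t p q i →
        resistanceDist G u v = (2 * (N - n i) + t + 1) / ((N - n i) * (N - n i + t))) ∧
      (u ∈ cliquePart t p q i → v ∈ cliquePart t p q i → G.Adj u v →
        resistanceDist G u v = 2 / (N - n i + t)) ∧
      (u ∈ cliquePart t p q i → v ∈ cliquePart t p q i → ¬ G.Adj u v →
        resistanceDist G u v = 2 * (N - n i + 1) / ((N - n i) * (N - n i + t)))) ∧
    -- (ii)(a)
    (∀ i j, M.Adj i j → ∀ R₁ : ℝ, R₁ = (n i + n j) / (n i * n j * (N - n i - n j)) → ∀ u v,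
      (u ∈ isolatedPart t p q i → v ∈ isolatedPart t p q j →
        resistanceDist G u v = R₁ + ((n i - 1) / (n i * (N - n i - n j)) +
          (n j - 1) / (n j * (N - n i - n j)))) ∧
      (u ∈ cliquePart t p q i → v ∈ isolatedPart t p q j →
        resistanceDist G u v = R₁ +
          ((N - n i - n j + 1) / ((N - n i - n j) * (N - n i - n j + t)) +
            (n i * n j - n i - n j) / (n i * n j * (N - n i - n j)))) ∧
      (u ∈ cliquePart t p q i → v ∈ cliquePart t p q j →
        resistanceDist G u v = R₁ +
          (2 * (N - n i - n j + 1) / ((N - n i - n j) * (N - n i - n j + t)) -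
            (n i + n j) / (n i * n j * (N - n i - n j))))) ∧
    -- (ii)(b)
    (∀ i j l l', i ≠ j → ¬ M.Adj i j → M.Adj i l → M.Adj j l' →
      ∀ R₂ : ℝ, R₂ = (N - n i) / (N * n i * (N - n i - n l)) +
        (N - n j) / (N * n j * (N - n j - n l')) → ∀ u v,
      (u ∈ isolatedPart t p q i → v ∈ isolatedPart t p q j →
        resistanceDist G u v = R₂ + ((n i - 1) / (n i * (N - n i - n l)) +
          (n j - 1) / (n j * (N - n j - n l')))) ∧
      (u ∈ cliquePart t p q i → v ∈ isolatedPart t p q j →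
        resistanceDist G u v = R₂ +
          (((n i - 1) * (N - n i - n l + 1) + 1 - t) /
              (n i * (N - n i - n l) * (N - n i - n l + t)) +
            (n j - 1) / (n j * (N - n j - n l')))) ∧
      (u ∈ cliquePart t p q i → v ∈ cliquePart t p q j →
        resistanceDist G u v = R₂ +
          (((n i - 1) * (N - n i - n l + 1) + 1 - t) /
              (n i * (N - n i - n l) * (N - n i - n l + t)) +
            ((n j - 1) * (N - n j - n l' + 1) + 1 - t) /
              (n j * (N - n j - n l') * (N - n j - n l' + t))))) ∧
    -- (ii)(c)
    (∀ i j l, M.Adj i l → j ∉ M.verts →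
      ∀ R₃ : ℝ, R₃ = (N - n i) / (N * n i * (N - n i - n l)) + 1 / (N * n j) → ∀ u v,
      (u ∈ isolatedPart t p q i → v ∈ isolatedPart t p q j →
        resistanceDist G u v = R₃ + ((n i - 1) / (n i * (N - n i - n l)) +
          (n j - 1) / (n j * (N - n j)))) ∧
      (u ∈ isolatedPart t p q i → v ∈ cliquePart t p q j →
        resistanceDist G u v = R₃ + ((n i - 1) / (n i * (N - n i - n l)) +
          ((n j - 1) * (N - n j + 1) + 1 - t) / (n j * (N - n j) * (N - n j + t)))) ∧
      (u ∈ cliquePart t p q i → v ∈ isolatedPart t p q j →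
        resistanceDist G u v = R₃ +
          (((n i - 1) * (N - n i - n l + 1) + 1 - t) /
              (n i * (N - n i - n l) * (N - n i - n l + t)) +
            (n j - 1) / (n j * (N - n j)))) ∧
      (u ∈ cliquePart t p q i → v ∈ cliquePart t p q j →
        resistanceDist G u v = R₃ +
          (((n i - 1) * (N - n i - n l + 1) + 1 - t) /
              (n i * (N - n i - n l) * (N - n i - n l + t)) +
            ((n j - 1) * (N - n j + 1) + 1 - t) / (n j * (N - n j) * (N - n j + t))))) ∧
    -- (ii)(d)
    (∀ i j, i ≠ j → i ∉ M.verts → j ∉ M.verts →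
      ∀ R₄ : ℝ, R₄ = 1 / (N * n i) + 1 / (N * n j) → ∀ u v,
      (u ∈ isolatedPart t p q i → v ∈ isolatedPart t p q j →
        resistanceDist G u v = R₄ + ((n i - 1) / (n i * (N - n i)) +
          (n j - 1) / (n j * (N - n j)))) ∧
      (u ∈ cliquePart t p q i → v ∈ isolatedPart t p q j →
        resistanceDist G u v = R₄ +
          (((n i - 1) * (N - n i + 1) + 1 - t) / (n i * (N - n i) * (N - n i + t)) +
            (n j - 1) / (n j * (N - n j)))) ∧
      (u ∈ cliquePart t p q i → v ∈ cliquePart t p q j →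
        resistanceDist G u v = R₄ +
          (((n i - 1) * (N - n i + 1) + 1 - t) / (n i * (N - n i) * (N - n i + t)) +
            ((n j - 1) * (N - n j + 1) + 1 - t) / (n j * (N - n j) * (N - n j + t))))) := by
  subst hH hG
  have hJ := isJoinOfCliques_blowUp M hM t p q
  have sM : ∀ i l, M.Adj i l → ∀ a, N - n i - n l =
      Fintype.card (BlowUpVertex t p q) - classSize (partSetoid M hM t p q) ⟨i, a⟩ :=
    fun i l h a => by
      rw [classSize_partSetoid_of_adj hM t p q (x := ⟨i, a⟩) h, hn, hn, hN]; ring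
  have sU : ∀ i, i ∉ M.verts → ∀ a, N - n i =
      Fintype.card (BlowUpVertex t p q) - classSize (partSetoid M hM t p q) ⟨i, a⟩ :=
    fun i h a => by rw [classSize_partSetoid_of_notMem hM t p q (x := ⟨i, a⟩) h, hn, hN]
  have tC : ∀ i a, (t : ℝ) = classSize (cliqueSetoid t p q) ⟨i, Sum.inl a⟩ :=
    fun i a => (classSize_cliqueSetoid_inl i a).symm
  have tI : ∀ i a, (1 : ℝ) = classSize (cliqueSetoid t p q) ⟨i, Sum.inr a⟩ :=
    fun i a => (classSize_cliqueSetoid_inr i a).symm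
  have n0 : ∀ i, BlockVertex t (p i) (q i) → n i ≠ 0 := fun i a => by
    have : Nonempty (BlockVertex t (p i) (q i)) := ⟨a⟩
    rw [hn]; exact_mod_cast Fintype.card_ne_zero
  have N0 : N ≠ 0 := by
    have := hconn.nonempty
    rw [hN]; exact_mod_cast Fintype.card_ne_zero
  have t0 : (0 : ℝ) ≤ t := t.cast_nonneg
  -- Keeping s abstract lets one computation serve matched and unmatched parts.
  have samePart : ∀ i s, (∀ a, s = Fintype.card (BlowUpVertex t p q) -
      classSize (partSetoid M hM t p q) ⟨i, a⟩) → ∀ u v, u ≠ v →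
      (u ∈ isolatedPart t p q i → v ∈ isolatedPart t p q i →
        resistanceDist (blowUp ((⊤ : SimpleGraph (Fin k)).deleteEdges M.edgeSet) t p q) u v =
          2 / s) ∧
      (u ∈ cliquePart t p q i → v ∈ isolatedPart t p q i →
        resistanceDist (blowUp ((⊤ : SimpleGraph (Fin k)).deleteEdges M.edgeSet) t p q) u v =
          (2 * s + t + 1) / (s * (s + t))) ∧
      (u ∈ cliquePart t p q i → v ∈ cliquePart t p q i →
        (blowUp ((⊤ : SimpleGraph (Fin k)).deleteEdges M.edgeSet) t p q).Adj u v →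
        resistanceDist (blowUp ((⊤ : SimpleGraph (Fin k)).deleteEdges M.edgeSet) t p q) u v =
          2 / (s + t)) ∧
      (u ∈ cliquePart t p q i → v ∈ cliquePart t p q i →
        ¬ (blowUp ((⊤ : SimpleGraph (Fin k)).deleteEdges M.edgeSet) t p q).Adj u v →
        resistanceDist (blowUp ((⊤ : SimpleGraph (Fin k)).deleteEdges M.edgeSet) t p q) u v =
          2 * (s + 1) / (s * (s + t))) := by
    intro i s hs u v huv
    have hB : ∀ a b, partSetoid M hM t p q ⟨i, a⟩ ⟨i, b⟩ := fun _ _ => Or.inl rfl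
    refine ⟨?_, ?_, ?_, ?_⟩
    · rintro ⟨a, rfl⟩ ⟨b, rfl⟩
      have hC : ¬ cliqueSetoid t p q ⟨i, Sum.inr a⟩ ⟨i, Sum.inr b⟩ := fun h => huv <| by
        have := cliqueSetoid_mk.1 h
        simpa [blockClique] using this
      obtain ⟨h, hR⟩ := hJ.resistanceDist_of_rel hconn (hB _ _) hC (hs _) (tI i a) (tI i b)
      rw [hR]
      field_simp
      ring
    · rintro ⟨a, rfl⟩ ⟨b, rfl⟩
      have hC : ¬ cliqueSetoid t p q ⟨i, Sum.inl a⟩ ⟨i, Sum.inr b⟩ := fun h => by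
        have := cliqueSetoid_mk.1 h
        simp [blockClique] at this
      obtain ⟨h, hR⟩ := hJ.resistanceDist_of_rel hconn (hB _ _) hC (hs _) (tC i a) (tI i b)
      rw [hR]
      field_simp
      ring
    · rintro ⟨a, rfl⟩ ⟨b, rfl⟩ hadj
      have hC := (((hJ.adj_iff _ _).1 hadj).resolve_left (not_not.2 (hB _ _))).1
      exact hJ.resistanceDist_of_clique hC huv (hs _) (tC i a)
    · rintro ⟨a, rfl⟩ ⟨b, rfl⟩ hadj
      have hC : ¬ cliqueSetoid t p q ⟨i, Sum.inl a⟩ ⟨i, Sum.inl b⟩ := fun h =>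
        hadj ((hJ.adj_iff _ _).2 (Or.inr ⟨h, huv⟩))
      obtain ⟨h, hR⟩ := hJ.resistanceDist_of_rel hconn (hB _ _) hC (hs _) (tC i a) (tC i b)
      rw [hR]
      ring
  -- The formula for R is assumed only under positivity of s and s', which `unmatched_term` needs
  -- and which is known only once both parts are seen to contain a vertex.
  have joinedParts : ∀ i j s s', (∀ a, s = Fintype.card (BlowUpVertex t p q) -
      classSize (partSetoid M hM t p q) ⟨i, a⟩) → (∀ a, s' = Fintype.card (BlowUpVertex t p q) -
      classSize (partSetoid M hM t p q) ⟨j, a⟩) → i ≠ j → ¬ M.Adj i j → ∀ R : ℝ,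
      (0 < s → 0 < s' → R = (N - n i) / (N * n i * s) + (N - n j) / (N * n j * s')) → ∀ u v,
      (u ∈ isolatedPart t p q i → v ∈ isolatedPart t p q j →
        resistanceDist (blowUp ((⊤ : SimpleGraph (Fin k)).deleteEdges M.edgeSet) t p q) u v =
          R + ((n i - 1) / (n i * s) + (n j - 1) / (n j * s'))) ∧
      (u ∈ isolatedPart t p q i → v ∈ cliquePart t p q j →
        resistanceDist (blowUp ((⊤ : SimpleGraph (Fin k)).deleteEdges M.edgeSet) t p q) u v =
          R + ((n i - 1) / (n i * s) +
            ((n j - 1) * (s' + 1) + 1 - t) / (n j * s' * (s' + t)))) ∧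
      (u ∈ cliquePart t p q i → v ∈ isolatedPart t p q j →
        resistanceDist (blowUp ((⊤ : SimpleGraph (Fin k)).deleteEdges M.edgeSet) t p q) u v =
          R + (((n i - 1) * (s + 1) + 1 - t) / (n i * s * (s + t)) +
            (n j - 1) / (n j * s'))) ∧
      (u ∈ cliquePart t p q i → v ∈ cliquePart t p q j →
        resistanceDist (blowUp ((⊤ : SimpleGraph (Fin k)).deleteEdges M.edgeSet) t p q) u v =
          R + (((n i - 1) * (s + 1) + 1 - t) / (n i * s * (s + t)) +
            ((n j - 1) * (s' + 1) + 1 - t) / (n j * s' * (s' + t)))) := by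
    intro i j s s' hs hs' hij hM' R hR u v
    have hB : ∀ a b, ¬ partSetoid M hM t p q ⟨i, a⟩ ⟨j, b⟩ := fun _ _ => not_or.2 ⟨hij, hM'⟩
    refine ⟨?_, ?_, ?_, ?_⟩
    · rintro ⟨a, rfl⟩ ⟨b, rfl⟩
      obtain ⟨h, h', e⟩ := hJ.resistanceDist_of_not_rel (hB _ _) hN (hN ▸ hs _) (hN ▸ hs' _)
        (tI i a) (tI j b)
      rw [e, hR h h', ← isolated_term N0 (n0 i (Sum.inr a)) h,
        ← isolated_term N0 (n0 j (Sum.inr b)) h']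
      ring
    · rintro ⟨a, rfl⟩ ⟨b, rfl⟩
      obtain ⟨h, h', e⟩ := hJ.resistanceDist_of_not_rel (hB _ _) hN (hN ▸ hs _) (hN ▸ hs' _)
        (tI i a) (tC j b)
      rw [e, hR h h', ← isolated_term N0 (n0 i (Sum.inr a)) h,
        ← clique_term N0 (n0 j (Sum.inl b)) h' t0]
      ring
    · rintro ⟨a, rfl⟩ ⟨b, rfl⟩
      obtain ⟨h, h', e⟩ := hJ.resistanceDist_of_not_rel (hB _ _) hN (hN ▸ hs _) (hN ▸ hs' _)
        (tC i a) (tI j b)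
      rw [e, hR h h', ← clique_term N0 (n0 i (Sum.inl a)) h t0,
        ← isolated_term N0 (n0 j (Sum.inr b)) h']
      ring
    · rintro ⟨a, rfl⟩ ⟨b, rfl⟩
      obtain ⟨h, h', e⟩ := hJ.resistanceDist_of_not_rel (hB _ _) hN (hN ▸ hs _) (hN ▸ hs' _)
        (tC i a) (tC j b)
      rw [e, hR h h', ← clique_term N0 (n0 i (Sum.inl a)) h t0,
        ← clique_term N0 (n0 j (Sum.inl b)) h' t0]
      ring
  refine ⟨fun i l h => samePart i _ (sM i l h), fun i h => samePart i _ (sU i h), ?_, ?_, ?_, ?_⟩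
  · rintro i j hij R rfl u v
    have hB : ∀ a b, partSetoid M hM t p q ⟨i, a⟩ ⟨j, b⟩ := fun _ _ => Or.inr hij
    have hC : ∀ a b, ¬ cliqueSetoid t p q ⟨i, a⟩ ⟨j, b⟩ :=
      fun _ _ h => hij.ne (cliqueSetoid_fst h)
    refine ⟨?_, ?_, ?_⟩
    · rintro ⟨a, rfl⟩ ⟨b, rfl⟩
      obtain ⟨h, hR⟩ := hJ.resistanceDist_of_rel hconn (hB _ _) (hC _ _) (sM i j hij _)
        (tI i a) (tI j b)
      have hi := n0 i (Sum.inr a)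
      have hj := n0 j (Sum.inr b)
      rw [hR]
      generalize N - n i - n j = s at h ⊢
      field_simp
      ring
    · rintro ⟨a, rfl⟩ ⟨b, rfl⟩
      obtain ⟨h, hR⟩ := hJ.resistanceDist_of_rel hconn (hB _ _) (hC _ _) (sM i j hij _)
        (tC i a) (tI j b)
      have hi := n0 i (Sum.inl a)
      have hj := n0 j (Sum.inr b)
      rw [hR]
      generalize N - n i - n j = s at h ⊢
      field_simp
      ring
    · rintro ⟨a, rfl⟩ ⟨b, rfl⟩
      obtain ⟨h, hR⟩ := hJ.resistanceDist_of_rel hconn (hB _ _) (hC _ _) (sM i j hij _)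
        (tC i a) (tC j b)
      -- The subtracted fraction is R₁ itself, so the two cancel without any nonvanishing of the
      -- part sizes.
      rw [hR]
      ring
  · rintro i j l l' hij hM' hl hl' R rfl u v
    -- The discarded case is the third with i and j exchanged; only in (c) are the two parts of
    -- different kinds.
    obtain ⟨h1, -, h3, h4⟩ := joinedParts i j _ _ (sM i l hl) (sM j l' hl') hij hM' _
      (fun _ _ => rfl) u v
    exact ⟨h1, h3, h4⟩
  · rintro i j l hl hj R rfl u v
    exact joinedParts i j _ _ (sM i l hl) (sU j hj) (fun e => hj (e ▸ M.edge_vert hl))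
      (fun h => hj (M.edge_vert h.symm)) _ (fun _ h => by rw [unmatched_term h]) u v
  · rintro i j hij hi hj R rfl u v
    obtain ⟨h1, -, h3, h4⟩ := joinedParts i j _ _ (sU i hi) (sU j hj) hij
      (fun h => hi (M.edge_vert h)) (1 / (N * n i) + 1 / (N * n j))
      (fun h h' => by rw [unmatched_term h, unmatched_term h']) u v
    exact ⟨h1, h3, h4⟩
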